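/- Let $h$ be a Herglotz--Nevanlinna function, i.e. $h$ is analytic on $\mathbb{C}\setminus\mathbb{R}$, $h(\overline\zeta)=\overline{h(\zeta)}$ and $\operatorname{Im}h(\zeta)\ge 0$ for $\operatorname{Im}\zeta>0$. Assume that there are a constant $c$ and a finite non-negative Borel measure $\nu$ on $\mathbb{R}$ with $$h(\zeta)=c+\int_{\mathbb{R}}\frac{1+t\zeta}{t-\zeta}\,d\nu(t)\qquad(\zeta\in\mathbb{C}\setminus\mathbb{R}),$$ and regard $h$ as an analytic function on $\mathrm{dom}(h)=\mathbb{C}\setminus\mathrm{supp}\,\nu$. Let $\mathcal{L}(h)$ be the reproducing kernel Hilbert space of functions on $\mathrm{dom}(h)$ with kernel $$N_h(\zeta,w)=\frac{h(\zeta)-\overline{h(w)}}{\zeta-\overline w}\quad(\zeta\ne\overline w),\qquad N_h(w,\overline w)=h'(w),$$ and let $\mathcal{M}(h)$ be the set of all analytic functions $g:\mathrm{dom}(h)\to\mathbb{C}$ such that for every $w\in\mathrm{dom}(h)$ the difference quotient $D_w(g)(\zeta)=\frac{g(\zeta)-g(w)}{\zeta-w}$ (with $D_w(g)(w)=g'(w)$)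 belongs to $\mathcal{L}(h)$. Put $d\mu=(1+t^2)\,d\nu$. Then $\frac1{t-i}\in L^2(\mathbb{R},\mu)$, so that $\frac{f(t)}{t-i}\,d\mu(t)$ is a finite complex measure for every $f\in L^2(\mathbb{R},\mu)$, and $\mathcal{M}(h)$ consists exactly of the functions $$g(\zeta)=a+\int_{\mathbb{R}}\frac{1+t\zeta}{t-\zeta}\cdot\frac{f(t)}{t-i}\,d\mu(t)\qquad(\zeta\in\mathrm{dom}(h)),$$ where $f\in L^2(\mathbb{R},\mu)$ and $a\in\mathbb{C}$ are arbitrary. An analytic function on $\mathrm{dom}(h)$ already belongs to $\mathcal{M}(h)$ if it is given by this formula, for some such $f$ and $a$, on $\mathbb{C}\setminus\mathbb{R}$. Moreover, every $g\in\mathcal{M}(h)$ is, on $\mathbb{C}\setminus\mathbb{R}$, a quasi-Herglotz function, i.e. $g=(h_1-h_2)+i(h_3-h_4)$ with Herglotz--Nevanlinna functions $h_1,\dots,h_4$. -/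

import Mathlib

open MeasureTheory

noncomputable section

namespace QuasiHerglotz

/-- The set `ℂ \ ℝ`. -/
def offReal : Set ℂ := {z | z.im ≠ 0}

/-- Herglotz-Nevanlinna functions on `ℂ \ ℝ` (values on the real line are irrelevant). -/
structure IsHerglotzNevanlinna (q : ℂ → ℂ) : Prop where
  analytic : AnalyticOnNhd ℂ q offReal
  symm : ∀ z ∈ offReal, q (starRingEnd ℂ z) = starRingEnd ℂ (q z)
  im_nonneg : ∀ z : ℂ, 0 < z.im → 0 ≤ (q z).im

/-- Quasi-Herglotz functions on `ℂ \ ℝ`: `q = (h₁ - h₂) + i (h₃ - h₄)` with Herglotz-Nevanlinna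
functions `h₁, h₂, h₃, h₄`. -/
def IsQuasiHerglotz (q : ℂ → ℂ) : Prop :=
  AnalyticOnNhd ℂ q offReal ∧
    ∃ h₁ h₂ h₃ h₄ : ℂ → ℂ,
      IsHerglotzNevanlinna h₁ ∧ IsHerglotzNevanlinna h₂ ∧
      IsHerglotzNevanlinna h₃ ∧ IsHerglotzNevanlinna h₄ ∧
      ∀ z ∈ offReal, q z = (h₁ z - h₂ z) + Complex.I * (h₃ z - h₄ z)

/-- The domain of analyticity `ℂ \ supp ν` of a function represented by the measure `ν`. -/
def dom (ν : Measure ℝ) : Set ℂ := ((fun t : ℝ => (t : ℂ)) '' ν.support)ᶜ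

/-- `h` is a Herglotz-Nevanlinna function, regarded as an analytic function on its domain of
analyticity `ℂ \ supp ν`, with the integral representation
`h(z) = c + ∫ (1 + t z) / (t - z) dν(t)`, that is, without linear term. -/
structure IsRepresentedBy (h : ℂ → ℂ) (c : ℂ) (ν : Measure ℝ) : Prop where
  herglotz : IsHerglotzNevanlinna h
  analytic : AnalyticOnNhd ℂ h (dom ν)
  integral_rep : ∀ z ∈ offReal,
    h z = c + ∫ t : ℝ, (1 + (t : ℂ) * z) / ((t : ℂ) - z) ∂ν

open Classical in
/-- The Nevanlinna kernel `N_h(z, w) = (h(z) - conj h(w)) / (z - conj w)`, with the value `h'(z)`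
if `z = conj w`. -/
def nevanlinnaKernel (h : ℂ → ℂ) (z w : ℂ) : ℂ :=
  if z = starRingEnd ℂ w then deriv h z
  else (h z - starRingEnd ℂ (h w)) / (z - starRingEnd ℂ w)

/-- The functions that belong to the reproducing kernel Hilbert space of functions on `X` with
kernel `K`. That Hilbert space is unique as a space of functions, and it exists exactly if `K` is
positive semidefinite. In Mathlib `RKHS.kernel H z w` is the operator `v ↦ K(z, w) v` on `ℂ`,
where `K(·, w)` is the element of `H` that represents evaluation at `w`. -/
def reproducingKernelSpace {X : Type} (K : X → X → ℂ) : Set (X → ℂ) :=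
  {f | ∃ (H : Type) (_ : NormedAddCommGroup H) (_ : InnerProductSpace ℂ H)
      (_ : CompleteSpace H) (_ : RKHS ℂ H X ℂ),
      (∀ z w : X, RKHS.kernel H z w (1 : ℂ) = K z w) ∧ ∃ F : H, ∀ z : X, F z = f z}

/-- The Herglotz space `L(h)`: the reproducing kernel Hilbert space on the domain `U` of `h` with
the Nevanlinna kernel of `h`. -/
def herglotzSpace (h : ℂ → ℂ) (U : Set ℂ) : Set (U → ℂ) :=
  reproducingKernelSpace fun z w : U => nevanlinnaKernel h z w

/-- The space `M(h)`: the analytic functions `g` on the domain `U` of `h` all of whose difference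
quotients `D_w(g)(z) = (g(z) - g(w)) / (z - w)`, with the value `g'(w)` at `z = w`, are in `L(h)`.
A function on `U` is represented by any extension of it to `ℂ`; membership depends only on its
values on the open set `U`. -/
def spaceM (h : ℂ → ℂ) (U : Set ℂ) : Set (ℂ → ℂ) :=
  {g | AnalyticOnNhd ℂ g U ∧ ∀ w ∈ U, (fun z : U => dslope g w z) ∈ herglotzSpace h U}

/-- The measure `dμ = (1 + t²) dν`. -/
def weighted (ν : Measure ℝ) : Measure ℝ := ν.withDensity fun t => ENNReal.ofReal (1 + t ^ 2)

/-- `a + ∫ (1 + t z) / (t - z) · (f(t) / (t - i)) dμ(t)`. -/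
def paramFun (μ : Measure ℝ) (f : ℝ → ℂ) (a z : ℂ) : ℂ :=
  a + ∫ t : ℝ, (1 + (t : ℂ) * z) / ((t : ℂ) - z) * (f t / ((t : ℂ) - Complex.I)) ∂μ

end QuasiHerglotz

end

open Filter Topology

/-! Everything reduces to Cauchy transforms. Since (1 + t²)/((t - i)(t + i)) = 1, the representation
of h gives N_h(z, w) = ∫ dμ(t)/((t - z)(t - conj w)). This is a Gram kernel of the vectors u_z =
1/(t - conj z) in L²(μ), so L(h) consists exactly of the Cauchy transforms of functions in L²(μ)
(`mem_reproducingKernelSpace_iff`, `mem_herglotzSpace_iff`).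

The identity (1 + tz)/((t - z)(t - i)) = (z + i)/(t - z) - i/(t - i) writes the parametrised
function as a constant plus (z + i) times the Cauchy transform of f (`paramFun_eq`). Hence D_{-i}(g)
in L(h) already forces the formula. Conversely, D_w(g) is the Cauchy transform of (t + i)/(t - w) ·
f, again in L²(μ) because the multiplier is bounded on supp ν. Splitting f/(t - i) into positive and
negative parts of its real and imaginary parts yields the quasi-Herglotz decomposition. -/

namespace QuasiHerglotz

/-! ### Reproducing kernel spaces of Gram kernels -/

open scoped InnerProductSpace in
/-- Evaluation against a family `u` in a Hilbert space, on the closed span of the family. -/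
@[reducible] noncomputable def rkhsOfFamily {X E : Type} [NormedAddCommGroup E] [InnerProductSpace ℂ E]
    (u : X → E) : RKHS ℂ (Submodule.span ℂ (Set.range u)).topologicalClosure X ℂ where
  coeCLM := ContinuousLinearMap.pi fun x =>
    (innerSL ℂ (u x)).comp (Submodule.span ℂ (Set.range u)).topologicalClosure.subtypeL
  coeCLM_injective := by
    refine (injective_iff_map_eq_zero _).mpr fun f hf => ?_
    have hu : ∀ x, ⟪u x, (f : E)⟫_ℂ = 0 := fun x => congrFun hf x
    have hspan : (f : E) ∈ (Submodule.span ℂ (Set.range u))ᗮ := by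
      rw [Submodule.mem_orthogonal]
      intro v hv
      induction hv using Submodule.span_induction with
      | mem y hy => obtain ⟨x, rfl⟩ := hy; exact hu x
      | zero => simp
      | add y z _ _ hy hz => rw [inner_add_left, hy, hz, add_zero]
      | smul a y _ hy => rw [inner_smul_left, hy, mul_zero]
    rw [← Submodule.orthogonal_closure] at hspan
    have := (Submodule.mem_orthogonal _ _).1 hspan f f.2
    exact Subtype.ext (inner_self_eq_zero.1 this)

-- Equal Gram matrices make k x ↦ u x extend to a linear isometry of H into E; the image of F is the
-- required vector.
open scoped InnerProductSpace in
theorem exists_forall_inner_eq_of_gram_eq {X H E : Type} [NormedAddCommGroup H]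
    [InnerProductSpace ℂ H] [NormedAddCommGroup E] [InnerProductSpace ℂ E] [CompleteSpace E]
    (k : X → H) (u : X → E) (hk : Dense (Submodule.span ℂ (Set.range k) : Set H))
    (h : ∀ x y, ⟪u x, u y⟫_ℂ = ⟪k x, k y⟫_ℂ) (F : H) :
    ∃ e : E, ∀ x, ⟪u x, e⟫_ℂ = ⟪k x, F⟫_ℂ := by
  set a := Finsupp.linearCombination ℂ k
  set b := Finsupp.linearCombination ℂ u
  have hin : ∀ p, ⟪b p, b p⟫_ℂ = ⟪a p, a p⟫_ℂ := by
    intro p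
    simp only [a, b, Finsupp.linearCombination_apply, Finsupp.sum_inner, Finsupp.inner_sum,
      inner_smul_left, inner_smul_right, h]
  have hnorm : ∀ p, ‖b p‖ = ‖a p‖ := by
    intro p
    rw [norm_eq_sqrt_re_inner (𝕜 := ℂ), hin, ← norm_eq_sqrt_re_inner]
  have hd : DenseRange a := by
    rw [DenseRange]
    convert hk
    exact congrArg (fun s : Submodule ℂ H => (s : Set H)) (Finsupp.range_linearCombination ℂ)
  have hb : ∃ C, ∀ p, ‖b p‖ ≤ C * ‖a p‖ := ⟨1, fun p => by rw [hnorm, one_mul]⟩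
  -- The norm bound makes a p ↦ b p well defined, although `a` need not be injective; density
  -- extends it to all of H.
  set V := b.extendOfNorm a
  have hV : ∀ p, V (a p) = b p := LinearMap.extendOfNorm_eq hd hb
  have hVn : ∀ x, ‖V x‖ = ‖x‖ := by
    refine hd.induction ?_ (isClosed_eq (by fun_prop) (by fun_prop))
    rintro _ ⟨p, rfl⟩
    rw [hV, hnorm]
  let W : H →ₗᵢ[ℂ] E := ⟨V.toLinearMap, hVn⟩
  refine ⟨W F, fun x => ?_⟩
  have hx : u x = W (k x) := by
    have := hV (Finsupp.single x 1)
    simp only [a, b, Finsupp.linearCombination_single, one_smul] at this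
    exact this.symm
  rw [hx, W.inner_map_map]

-- This removes the choice of Hilbert space in `reproducingKernelSpace`: an arbitrary one embeds
-- isometrically into E, and the closed span of the u x is one.
open scoped InnerProductSpace in
theorem mem_reproducingKernelSpace_iff {X E : Type} [NormedAddCommGroup E] [InnerProductSpace ℂ E]
    [CompleteSpace E] {K : X → X → ℂ} (u : X → E) (hK : ∀ x y, K x y = ⟪u x, u y⟫_ℂ) (f : X → ℂ) :
    f ∈ reproducingKernelSpace K ↔ ∃ e : E, ∀ x, f x = ⟪u x, e⟫_ℂ := by
  constructor
  · rintro ⟨H, _, _, _, _, hker, F, hF⟩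
    have hdense : Dense (Submodule.span ℂ (Set.range fun x => RKHS.kerFun H x (1 : ℂ)) : Set H) := by
      rw [Submodule.dense_iff_topologicalClosure_eq_top, eq_top_iff, ← RKHS.kerFun_dense H]
      refine Submodule.topologicalClosure_mono (Submodule.span_le.2 ?_)
      rintro _ ⟨x, v, rfl⟩
      have hv : RKHS.kerFun H x v = v • RKHS.kerFun H x (1 : ℂ) := by
        rw [← map_smul, smul_eq_mul, mul_one]
      rw [hv]
      exact Submodule.smul_mem _ _ (Submodule.subset_span ⟨x, rfl⟩)
    obtain ⟨e, he⟩ := exists_forall_inner_eq_of_gram_eq (fun x => RKHS.kerFun H x (1 : ℂ)) u hdense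
      (fun x y => by
        rw [← hK, ← hker, RKHS.kerFun_inner, RKHS.kerFun_apply]
        simp) F
    refine ⟨e, fun x => ?_⟩
    rw [he, ← hF]
    simp
  · rintro ⟨e, he⟩
    set S := (Submodule.span ℂ (Set.range u)).topologicalClosure
    have hu : ∀ x, u x ∈ S := fun x =>
      Submodule.le_topologicalClosure _ (Submodule.subset_span ⟨x, rfl⟩)
    have hcS : IsClosed (S : Set E) := Submodule.isClosed_topologicalClosure _
    have : CompleteSpace S := hcS.completeSpace_coe
    let _ := rkhsOfFamily u
    have happ : ∀ (F : S) (x : X), F x = ⟪u x, (F : E)⟫_ℂ := fun F x => rfl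
    have hkf : ∀ x, RKHS.kerFun S x (1 : ℂ) = ⟨u x, hu x⟩ := by
      intro x
      refine ext_inner_right ℂ fun F => ?_
      rw [RKHS.kerFun_inner, happ]
      simp
    refine ⟨S, inferInstance, inferInstance, inferInstance, inferInstance, fun x y => ?_,
      -- Projecting e onto the closed span leaves its inner products with the u x unchanged.
      S.orthogonalProjectionOnto e, fun x => ?_⟩
    · rw [← RKHS.kerFun_apply, hkf, happ, hK]
    · rw [happ, he]
      exact S.inner_orthogonalProjectionOnto_eq_of_mem_left (⟨u x, hu x⟩ : S) e


/-! ### Cauchy transforms of functions in L²(μ) -/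

/-- The Cauchy transform of the complex measure `F dμ`. -/
noncomputable def cauchyTransform (μ : Measure ℝ) (F : ℝ → ℂ) (z : ℂ) : ℂ :=
  ∫ t : ℝ, F t / ((t : ℂ) - z) ∂μ

theorem isOpen_dom (ν : Measure ℝ) : IsOpen (dom ν) :=
  (Complex.isometry_ofReal.isClosedEmbedding.isClosedMap _ Measure.isClosed_support).isOpen_compl

theorem offReal_subset_dom (ν : Measure ℝ) : offReal ⊆ dom ν := by
  rintro z hz ⟨t, -, rfl⟩
  exact hz (Complex.ofReal_im t)

theorem closure_offReal : closure offReal = Set.univ := by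
  have : offReal = Complex.im ⁻¹' {0}ᶜ := rfl
  rw [this, Complex.closure_preimage_im, closure_compl_singleton, Set.preimage_univ]

theorem eqOn_dom_of_eqOn_offReal {ν : Measure ℝ} {f g : ℂ → ℂ} (hf : ContinuousOn f (dom ν))
    (hg : ContinuousOn g (dom ν)) (h : Set.EqOn f g offReal) : Set.EqOn f g (dom ν) :=
  h.of_subset_closure hf hg (offReal_subset_dom ν) (by simp [closure_offReal])

theorem conj_mem_dom {ν : Measure ℝ} {z : ℂ} (hz : z ∈ dom ν) : starRingEnd ℂ z ∈ dom ν := by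
  rintro ⟨t, ht, h⟩
  refine hz ⟨t, ht, ?_⟩
  have := congrArg (starRingEnd ℂ) h
  simpa using this

theorem ofReal_sub_ne_zero {ν : Measure ℝ} {z : ℂ} (hz : z ∈ dom ν) {t : ℝ} (ht : t ∈ ν.support) :
    (t : ℂ) - z ≠ 0 := fun h => hz ⟨t, ht, sub_eq_zero.1 h⟩

theorem exists_le_norm_sub {ν : Measure ℝ} {z : ℂ} (hz : z ∈ dom ν) :
    ∃ δ > 0, ∀ t ∈ ν.support, δ ≤ ‖(t : ℂ) - z‖ := by
  obtain ⟨δ, hδ, hb⟩ := Metric.isOpen_iff.1 (isOpen_dom ν) z hz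
  refine ⟨δ, hδ, fun t ht => ?_⟩
  by_contra! hlt
  exact hb (mem_ball_iff_norm.2 hlt) ⟨t, ht, rfl⟩

theorem ofReal_sub_I_ne_zero (t : ℝ) : (t : ℂ) - Complex.I ≠ 0 := by
  intro h
  simpa using congrArg Complex.im h

theorem ofReal_add_I_ne_zero (t : ℝ) : (t : ℂ) + Complex.I ≠ 0 := by
  intro h
  simpa using congrArg Complex.im h

theorem I_mem_dom (ν : Measure ℝ) : Complex.I ∈ dom ν := offReal_subset_dom ν (by simp [offReal])

theorem neg_I_mem_dom (ν : Measure ℝ) : -Complex.I ∈ dom ν :=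
  offReal_subset_dom ν (by simp [offReal])

theorem weighted_absolutelyContinuous (ν : Measure ℝ) : weighted ν ≪ ν :=
  withDensity_absolutelyContinuous _ _

theorem ae_weighted_mem_support (ν : Measure ℝ) : ∀ᵐ t ∂(weighted ν), t ∈ ν.support :=
  (weighted_absolutelyContinuous ν).ae_le Measure.support_mem_ae

theorem integral_weighted (ν : Measure ℝ) (g : ℝ → ℂ) :
    ∫ t, g t ∂(weighted ν) = ∫ t, (1 + (t : ℂ) ^ 2) * g t ∂ν := by
  rw [weighted, integral_withDensity_eq_integral_toReal_smul (by fun_prop) (by simp)]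
  refine integral_congr_ae (Eventually.of_forall fun t => ?_)
  simp only
  rw [ENNReal.toReal_ofReal (by positivity), Complex.real_smul]
  push_cast
  ring

/-- Since |t - i|² = 1 + t² cancels the weight, the squared norm is the total mass of ν. -/
theorem memLp_inv_ofReal_sub_I (ν : Measure ℝ) [IsFiniteMeasure ν] :
    MemLp (fun t : ℝ => 1 / ((t : ℂ) - Complex.I)) 2 (weighted ν) := by
  have hm : Measurable fun t : ℝ => 1 / ((t : ℂ) - Complex.I) := by fun_prop
  rw [memLp_two_iff_integrable_sq_norm hm.aestronglyMeasurable, weighted,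
    integrable_withDensity_iff_integrable_smul' (by fun_prop) (by simp)]
  refine (integrable_const (1 : ℝ)).congr (Eventually.of_forall fun t => ?_)
  simp only
  have h : ‖(t : ℂ) - Complex.I‖ ^ 2 = 1 + t ^ 2 := by
    rw [← Complex.normSq_eq_norm_sq, Complex.normSq_apply]
    simp
    ring
  rw [ENNReal.toReal_ofReal (by positivity), norm_div, norm_one, div_pow, h, smul_eq_mul]
  field_simp

theorem memLp_bdd_mul {ν : Measure ℝ} {F φ : ℝ → ℂ} (hF : MemLp F 2 (weighted ν))
    (hφ : Measurable φ) {C : ℝ} (hC : ∀ t ∈ ν.support, ‖φ t‖ ≤ C) :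
    MemLp (fun t => φ t * F t) 2 (weighted ν) := by
  refine MemLp.of_le_mul (c := C) hF (hφ.aestronglyMeasurable.mul hF.1) ?_
  filter_upwards [ae_weighted_mem_support ν] with t ht
  rw [norm_mul]
  exact mul_le_mul_of_nonneg_right (hC t ht) (norm_nonneg _)

theorem memLp_div_sub {ν : Measure ℝ} {F : ℝ → ℂ} (hF : MemLp F 2 (weighted ν)) {z : ℂ}
    (hz : z ∈ dom ν) : MemLp (fun t : ℝ => F t / ((t : ℂ) - z)) 2 (weighted ν) := by
  obtain ⟨δ, hδ, hle⟩ := exists_le_norm_sub hz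
  simp only [div_eq_inv_mul]
  refine memLp_bdd_mul hF (by fun_prop) (C := δ⁻¹) fun t ht => ?_
  rw [norm_inv]
  exact inv_anti₀ hδ (hle t ht)

/-- The multiplier equals 1 + (z - w)/(t - z), which is bounded on supp ν even when the support is
unbounded. -/
theorem memLp_sub_div_sub_mul {ν : Measure ℝ} {F : ℝ → ℂ} (hF : MemLp F 2 (weighted ν)) {z : ℂ}
    (hz : z ∈ dom ν) (w : ℂ) :
    MemLp (fun t : ℝ => ((t : ℂ) - w) / ((t : ℂ) - z) * F t) 2 (weighted ν) := by
  refine (hF.add ((memLp_div_sub hF hz).const_mul (z - w))).ae_eq ?_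
  filter_upwards [ae_weighted_mem_support ν] with t ht
  have := ofReal_sub_ne_zero hz ht
  simp only [Pi.add_apply]
  field_simp
  ring

theorem memLp_inv_ofReal_sub (ν : Measure ℝ) [IsFiniteMeasure ν] {z : ℂ} (hz : z ∈ dom ν) :
    MemLp (fun t : ℝ => ((t : ℂ) - z)⁻¹) 2 (weighted ν) := by
  refine (memLp_sub_div_sub_mul (memLp_inv_ofReal_sub_I ν) hz Complex.I).ae_eq ?_
  filter_upwards [ae_weighted_mem_support ν] with t ht
  have := ofReal_sub_ne_zero hz ht
  have := ofReal_sub_I_ne_zero t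
  field_simp

theorem integrable_div_sub {ν : Measure ℝ} [IsFiniteMeasure ν] {F : ℝ → ℂ}
    (hF : MemLp F 2 (weighted ν)) {z : ℂ} (hz : z ∈ dom ν) :
    Integrable (fun t : ℝ => F t / ((t : ℂ) - z)) (weighted ν) := by
  simp only [div_eq_mul_inv]
  exact hF.integrable_mul (memLp_inv_ofReal_sub ν hz)

theorem continuousAt_cauchyTransform {ν : Measure ℝ} [IsFiniteMeasure ν] {F : ℝ → ℂ}
    (hF : MemLp F 2 (weighted ν)) {z : ℂ} (hz : z ∈ dom ν) :
    ContinuousAt (cauchyTransform (weighted ν) F) z := by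
  obtain ⟨δ, hδ, hle⟩ := exists_le_norm_sub hz
  -- If z has distance at least δ from supp ν and |w - z| < δ/2, then |t - z| ≤ 2|t - w| on the
  -- support; hence the factor 2.
  refine continuousAt_of_dominated (bound := fun t => 2 * ‖F t / ((t : ℂ) - z)‖) ?_ ?_
    ((integrable_div_sub hF hz).norm.const_mul 2) ?_
  · filter_upwards [(isOpen_dom ν).mem_nhds hz] with w hw
    exact (integrable_div_sub hF hw).1
  · filter_upwards [Metric.ball_mem_nhds z (half_pos hδ)] with w hw
    filter_upwards [ae_weighted_mem_support ν] with t ht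
    have h1 := hle t ht
    have h2 : ‖w - z‖ < δ / 2 := mem_ball_iff_norm.1 hw
    have h3 : ‖(t : ℂ) - z‖ ≤ ‖(t : ℂ) - w‖ + ‖w - z‖ := by
      simpa using norm_add_le ((t : ℂ) - w) (w - z)
    have h4 : ‖(t : ℂ) - z‖ ≤ 2 * ‖(t : ℂ) - w‖ := by linarith
    have h5 : 0 < ‖(t : ℂ) - z‖ := by linarith
    have h6 : 0 < ‖(t : ℂ) - w‖ := by linarith
    rw [norm_div, norm_div, ← mul_div_assoc, div_le_div_iff₀ h6 h5]
    nlinarith [mul_le_mul_of_nonneg_left h4 (norm_nonneg (F t))]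
  · filter_upwards [ae_weighted_mem_support ν] with t ht
    have := ofReal_sub_ne_zero hz ht
    fun_prop (disch := assumption)

/-! ### Difference quotients and analyticity of the parametrised functions -/

theorem hasDerivAt_of_slope_eq {U : Set ℂ} (hU : IsOpen U) {g φ : ℂ → ℂ} {w : ℂ} (hw : w ∈ U)
    (hφ : ContinuousAt φ w) (h : ∀ z ∈ U, z ≠ w → g z - g w = (z - w) * φ z) :
    HasDerivAt g (φ w) w := by
  rw [hasDerivAt_iff_tendsto_slope]
  refine (hφ.tendsto.mono_left nhdsWithin_le_nhds).congr' ?_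
  filter_upwards [self_mem_nhdsWithin, mem_nhdsWithin_of_mem_nhds (hU.mem_nhds hw)] with z hne hz
  have : z - w ≠ 0 := sub_ne_zero.2 hne
  rw [slope_def_field, h z hz hne]
  field_simp

theorem dslope_eq_of_slope_eq {U : Set ℂ} (hU : IsOpen U) {g φ : ℂ → ℂ} {w : ℂ} (hw : w ∈ U)
    (hφ : ContinuousAt φ w) (h : ∀ z ∈ U, z ≠ w → g z - g w = (z - w) * φ z) {z : ℂ} (hz : z ∈ U) :
    dslope g w z = φ z := by
  rcases eq_or_ne z w with rfl | hne
  · rw [dslope_same, (hasDerivAt_of_slope_eq hU hw hφ h).deriv]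
  · have : z - w ≠ 0 := sub_ne_zero.2 hne
    rw [dslope_of_ne _ hne, slope_def_field, h z hz hne]
    field_simp

theorem integrable_paramFun {ν : Measure ℝ} [IsFiniteMeasure ν] {f : ℝ → ℂ}
    (hf : MemLp f 2 (weighted ν)) {z : ℂ} (hz : z ∈ dom ν) :
    Integrable (fun t : ℝ => (1 + (t : ℂ) * z) / ((t : ℂ) - z) * (f t / ((t : ℂ) - Complex.I)))
      (weighted ν) := by
  have h := (((integrable_div_sub hf hz).const_mul (z + Complex.I))).sub
    ((integrable_div_sub hf (I_mem_dom ν)).const_mul Complex.I)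
  refine h.congr ?_
  filter_upwards [ae_weighted_mem_support ν] with t ht
  have h1 := ofReal_sub_ne_zero hz ht
  have h2 := ofReal_sub_I_ne_zero t
  simp only [Pi.sub_apply]
  field_simp
  linear_combination (-f t) * Complex.I_sq

theorem paramFun_eq {ν : Measure ℝ} [IsFiniteMeasure ν] {f : ℝ → ℂ}
    (hf : MemLp f 2 (weighted ν)) (a : ℂ) {z : ℂ} (hz : z ∈ dom ν) :
    paramFun (weighted ν) f a z = a - Complex.I * cauchyTransform (weighted ν) f Complex.I +
      (z + Complex.I) * cauchyTransform (weighted ν) f z := by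
  rw [paramFun, cauchyTransform, cauchyTransform, ← integral_const_mul, ← integral_const_mul]
  rw [sub_add_eq_add_sub, add_sub_assoc, ← integral_sub
    ((integrable_div_sub hf hz).const_mul _) ((integrable_div_sub hf (I_mem_dom ν)).const_mul _)]
  congr 1
  refine integral_congr_ae ?_
  filter_upwards [ae_weighted_mem_support ν] with t ht
  have h1 := ofReal_sub_ne_zero hz ht
  have h2 := ofReal_sub_I_ne_zero t
  field_simp
  linear_combination (f t) * Complex.I_sq

theorem paramFun_sub {ν : Measure ℝ} [IsFiniteMeasure ν] {f : ℝ → ℂ}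
    (hf : MemLp f 2 (weighted ν)) (a : ℂ) {w z : ℂ} (hw : w ∈ dom ν) (hz : z ∈ dom ν) :
    paramFun (weighted ν) f a z - paramFun (weighted ν) f a w =
      (z - w) * cauchyTransform (weighted ν)
        (fun t : ℝ => ((t : ℂ) - -Complex.I) / ((t : ℂ) - w) * f t) z := by
  rw [paramFun_eq hf a hz, paramFun_eq hf a hw, add_sub_add_left_eq_sub]
  simp only [cauchyTransform]
  rw [← integral_const_mul, ← integral_const_mul, ← integral_const_mul, ← integral_sub
    ((integrable_div_sub hf hz).const_mul _) ((integrable_div_sub hf hw).const_mul _)]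
  refine integral_congr_ae ?_
  filter_upwards [ae_weighted_mem_support ν] with t ht
  have h1 := ofReal_sub_ne_zero hz ht
  have h2 := ofReal_sub_ne_zero hw ht
  field_simp
  ring

theorem dslope_eq_cauchyTransform {ν : Measure ℝ} [IsFiniteMeasure ν] {f : ℝ → ℂ}
    (hf : MemLp f 2 (weighted ν)) {a : ℂ} {g : ℂ → ℂ}
    (hg : Set.EqOn g (paramFun (weighted ν) f a) (dom ν)) {w z : ℂ} (hw : w ∈ dom ν)
    (hz : z ∈ dom ν) :
    dslope g w z = cauchyTransform (weighted ν)
      (fun t : ℝ => ((t : ℂ) - -Complex.I) / ((t : ℂ) - w) * f t) z :=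
  dslope_eq_of_slope_eq (isOpen_dom ν) hw
    (continuousAt_cauchyTransform (memLp_sub_div_sub_mul hf hw _) hw)
    (fun z hz _ => by rw [hg hz, hg hw, paramFun_sub hf a hw hz]) hz

/-- Continuity of the Cauchy transform that gives the difference quotient yields complex
differentiability, without differentiating under the integral. -/
theorem analyticOnNhd_of_eqOn_paramFun {ν : Measure ℝ} [IsFiniteMeasure ν] {f : ℝ → ℂ}
    (hf : MemLp f 2 (weighted ν)) {a : ℂ} {g : ℂ → ℂ}
    (hg : Set.EqOn g (paramFun (weighted ν) f a) (dom ν)) : AnalyticOnNhd ℂ g (dom ν) := by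
  refine DifferentiableOn.analyticOnNhd (fun w hw => ?_) (isOpen_dom ν)
  exact (hasDerivAt_of_slope_eq (isOpen_dom ν) hw
    (continuousAt_cauchyTransform (memLp_sub_div_sub_mul hf hw _) hw)
    (fun z hz _ => by rw [hg hz, hg hw, paramFun_sub hf a hw hz])).differentiableAt.differentiableWithinAt


/-! ### The spaces L(h) and M(h) -/

namespace IsRepresentedBy

variable {h : ℂ → ℂ} {c : ℂ} {ν : Measure ℝ}

/-- With f = 1/(t + i) the density f/(t - i) dμ is dν. Thus h is itself a parametrised function, and
the difference quotient formula applies to it. -/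
theorem eqOn_paramFun [IsFiniteMeasure ν] (hh : IsRepresentedBy h c ν) :
    Set.EqOn h (paramFun (weighted ν) (fun t : ℝ => ((t : ℂ) - -Complex.I)⁻¹) c) (dom ν) := by
  have hm := memLp_inv_ofReal_sub ν (neg_I_mem_dom ν)
  refine eqOn_dom_of_eqOn_offReal hh.analytic.continuousOn
    (analyticOnNhd_of_eqOn_paramFun hm (Set.eqOn_refl _ _)).continuousOn fun z hz => ?_
  rw [hh.integral_rep z hz, paramFun, integral_weighted]
  congr 1
  refine integral_congr_ae (Eventually.of_forall fun t => ?_)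
  have h1 := ofReal_sub_I_ne_zero t
  have h2 := ofReal_add_I_ne_zero t
  have h3 : (1 + (t : ℂ) ^ 2) * (((t : ℂ) - -Complex.I)⁻¹ / ((t : ℂ) - Complex.I)) = 1 := by
    rw [sub_neg_eq_add]
    field_simp
    linear_combination Complex.I_sq
  simp only
  linear_combination (-((1 + (t : ℂ) * z) / ((t : ℂ) - z))) * h3

theorem conj_apply (hh : IsRepresentedBy h c ν) {z : ℂ} (hz : z ∈ dom ν) :
    h (starRingEnd ℂ z) = starRingEnd ℂ (h z) := by
  refine eqOn_dom_of_eqOn_offReal (f := fun z => h (starRingEnd ℂ z))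
    (g := fun z => starRingEnd ℂ (h z)) ?_ ?_ (fun z hz => hh.herglotz.symm z hz) hz
  · exact hh.analytic.continuousOn.comp Complex.continuous_conj.continuousOn
      fun z hz => conj_mem_dom hz
  · exact Complex.continuous_conj.comp_continuousOn hh.analytic.continuousOn

/-- By symmetry of h the kernel is the difference quotient of h at conj w, including the diagonal
value; the factor t + i there cancels f = 1/(t + i). -/
theorem nevanlinnaKernel_eq [IsFiniteMeasure ν] (hh : IsRepresentedBy h c ν) {z w : ℂ}
    (hz : z ∈ dom ν) (hw : w ∈ dom ν) : nevanlinnaKernel h z w =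
      cauchyTransform (weighted ν) (fun t : ℝ => ((t : ℂ) - starRingEnd ℂ w)⁻¹) z := by
  have hk : nevanlinnaKernel h z w = dslope h (starRingEnd ℂ w) z := by
    rw [nevanlinnaKernel]
    split_ifs with hzw
    · rw [hzw, dslope_same]
    · rw [dslope_of_ne _ hzw, slope_def_field, hh.conj_apply hw]
  rw [hk, dslope_eq_cauchyTransform (memLp_inv_ofReal_sub ν (neg_I_mem_dom ν)) hh.eqOn_paramFun
    (conj_mem_dom hw) hz]
  refine integral_congr_ae (Eventually.of_forall fun t => ?_)
  have h2 := ofReal_add_I_ne_zero t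
  simp only [sub_neg_eq_add]
  field_simp

theorem mem_herglotzSpace_iff [IsFiniteMeasure ν] (hh : IsRepresentedBy h c ν) (f : dom ν → ℂ) :
    f ∈ herglotzSpace h (dom ν) ↔ ∃ F : ℝ → ℂ, MemLp F 2 (weighted ν) ∧
      ∀ z : dom ν, f z = cauchyTransform (weighted ν) F z := by
  -- The inner product is conjugate-linear in its first slot, so u z = 1/(t - conj z) makes ⟨u z, F⟩
  -- the Cauchy transform at z.
  let u : dom ν → Lp ℂ 2 (weighted ν) := fun z =>
    (memLp_inv_ofReal_sub ν (conj_mem_dom z.2)).toLp _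
  have hu : ∀ (z : dom ν) (F : ℝ → ℂ) (hF : MemLp F 2 (weighted ν)),
      inner ℂ (u z) (hF.toLp F) = cauchyTransform (weighted ν) F z := by
    intro z F hF
    rw [L2.inner_def]
    refine integral_congr_ae ?_
    filter_upwards [hF.coeFn_toLp, (memLp_inv_ofReal_sub ν (conj_mem_dom z.2)).coeFn_toLp]
      with t h1 h2
    rw [h1, h2, RCLike.inner_apply]
    simp [div_eq_mul_inv]
  refine (mem_reproducingKernelSpace_iff u
    (fun z w => (hh.nevanlinnaKernel_eq z.2 w.2).trans (hu z _ _).symm) f).trans ⟨?_, ?_⟩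
  · rintro ⟨e, he⟩
    refine ⟨e, Lp.memLp e, fun z => ?_⟩
    rw [he, ← hu z e (Lp.memLp e), Lp.toLp_coeFn]
  · rintro ⟨F, hF, hf⟩
    exact ⟨hF.toLp F, fun z => by rw [hf, hu]⟩

theorem mem_spaceM_iff [IsFiniteMeasure ν] (hh : IsRepresentedBy h c ν) (g : ℂ → ℂ) :
    g ∈ spaceM h (dom ν) ↔ ∃ (f : ℝ → ℂ) (a : ℂ), MemLp f 2 (weighted ν) ∧
      ∀ z ∈ dom ν, g z = paramFun (weighted ν) f a z := by
  constructor
  · rintro ⟨-, hg⟩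
    -- The point w = -i suffices, because it matches the factor z + i in `paramFun_eq`. The constant
    -- a is chosen so that the constant term there becomes g(-i).
    obtain ⟨F, hF, hD⟩ := (hh.mem_herglotzSpace_iff _).1 (hg _ (neg_I_mem_dom ν))
    refine ⟨F, g (-Complex.I) + Complex.I * cauchyTransform (weighted ν) F Complex.I, hF,
      fun z hz => ?_⟩
    rw [paramFun_eq hF _ hz, ← hD ⟨z, hz⟩]
    have := sub_smul_dslope g (-Complex.I) z
    rw [sub_neg_eq_add, smul_eq_mul] at this
    simp only [this]
    ring
  · rintro ⟨f, a, hf, hg⟩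
    refine ⟨analyticOnNhd_of_eqOn_paramFun hf hg, fun w hw => (hh.mem_herglotzSpace_iff _).2
      ⟨_, memLp_sub_div_sub_mul hf hw (-Complex.I), fun z => ?_⟩⟩
    exact dslope_eq_cauchyTransform hf hg hw z.2

end IsRepresentedBy

/-! ### Quasi-Herglotz decomposition -/

theorem im_moebius (t : ℝ) (z : ℂ) :
    ((1 + (t : ℂ) * z) / ((t : ℂ) - z)).im = (1 + t ^ 2) * z.im / Complex.normSq ((t : ℂ) - z) := by
  rw [Complex.div_im]
  simp
  ring

/-- The factor t - i cancels the denominator in `paramFun`, leaving the nonnegative measure φ dμ.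
Real φ and a give the symmetry; `im_moebius` gives the sign. -/
theorem isHerglotzNevanlinna_paramFun {ν : Measure ℝ} [IsFiniteMeasure ν] {φ : ℝ → ℝ}
    (hφ0 : ∀ t, 0 ≤ φ t)
    (hφ : MemLp (fun t : ℝ => (φ t : ℂ) * ((t : ℂ) - Complex.I)) 2 (weighted ν)) (a : ℝ) :
    IsHerglotzNevanlinna
      (paramFun (weighted ν) (fun t : ℝ => (φ t : ℂ) * ((t : ℂ) - Complex.I)) a) where
  analytic := (analyticOnNhd_of_eqOn_paramFun hφ (Set.eqOn_refl _ _)).mono (offReal_subset_dom ν)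
  symm z _ := by
    rw [paramFun, paramFun, map_add, Complex.conj_ofReal, ← integral_conj]
    congr 1
    refine integral_congr_ae (Eventually.of_forall fun t => ?_)
    simp only [mul_div_cancel_right₀ _ (ofReal_sub_I_ne_zero t)]
    simp
  im_nonneg z hz := by
    have hint := integrable_paramFun hφ (offReal_subset_dom ν (show z.im ≠ 0 from hz.ne'))
    rw [paramFun, Complex.add_im, Complex.ofReal_im, zero_add]
    have him := integral_im hint
    refine le_of_le_of_eq (integral_nonneg fun t => ?_) him
    simp only [RCLike.im_to_complex, mul_div_cancel_right₀ _ (ofReal_sub_I_ne_zero t), Complex.im_mul_ofReal, im_moebius]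
    have := hφ0 t
    have := Complex.normSq_nonneg ((t : ℂ) - z)
    simp only [Pi.zero_apply]
    positivity

theorem isQuasiHerglotz_of_eqOn_paramFun {ν : Measure ℝ} [IsFiniteMeasure ν] {f : ℝ → ℂ}
    (hf : MemLp f 2 (weighted ν)) {a : ℂ} {g : ℂ → ℂ}
    (hg : Set.EqOn g (paramFun (weighted ν) f a) (dom ν)) : IsQuasiHerglotz g := by
  refine ⟨(analyticOnNhd_of_eqOn_paramFun hf hg).mono (offReal_subset_dom ν), ?_⟩
  set q : ℝ → ℂ := fun t => f t / ((t : ℂ) - Complex.I)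
  have hqf : ∀ t : ℝ, q t * ((t : ℂ) - Complex.I) = f t := fun t =>
    div_mul_cancel₀ _ (ofReal_sub_I_ne_zero t)
  have hq : AEStronglyMeasurable q (weighted ν) := (memLp_div_sub hf (I_mem_dom ν)).1
  -- Each of the four parts of q is dominated by |q|, so after multiplication by t - i it is
  -- dominated by |f| and remains in L²(μ).
  have key : ∀ ψ : ℂ → ℝ, Continuous ψ → (∀ x, |ψ x| ≤ ‖x‖) →
      MemLp (fun t : ℝ => (ψ (q t) : ℂ) * ((t : ℂ) - Complex.I)) 2 (weighted ν) := by
    intro ψ hψ hle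
    refine MemLp.of_le hf ?_ (Eventually.of_forall fun t => ?_)
    · exact ((Complex.continuous_ofReal.comp hψ).comp_aestronglyMeasurable hq).mul
        (by fun_prop : Measurable fun t : ℝ => (t : ℂ) - Complex.I).aestronglyMeasurable
    · rw [← hqf t, norm_mul, norm_mul, Complex.norm_real]
      exact mul_le_mul_of_nonneg_right (hle _) (norm_nonneg _)
  have hmax : ∀ x : ℝ, |max x 0| ≤ |x| := fun x => by
    rw [abs_of_nonneg (le_max_right _ _)]
    exact max_le (le_abs_self x) (abs_nonneg x)
  have k1 := key (fun x => max x.re 0) (by fun_prop)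
    fun x => (hmax _).trans (Complex.abs_re_le_norm x)
  have k2 := key (fun x => max (-x.re) 0) (by fun_prop)
    fun x => (hmax _).trans ((abs_neg _).trans_le (Complex.abs_re_le_norm x))
  have k3 := key (fun x => max x.im 0) (by fun_prop)
    fun x => (hmax _).trans (Complex.abs_im_le_norm x)
  have k4 := key (fun x => max (-x.im) 0) (by fun_prop)
    fun x => (hmax _).trans ((abs_neg _).trans_le (Complex.abs_im_le_norm x))
  refine ⟨_, _, _, _, isHerglotzNevanlinna_paramFun (fun _ => le_max_right _ _) k1 a.re,
    isHerglotzNevanlinna_paramFun (fun _ => le_max_right _ _) k2 0,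
    isHerglotzNevanlinna_paramFun (fun _ => le_max_right _ _) k3 a.im,
    isHerglotzNevanlinna_paramFun (fun _ => le_max_right _ _) k4 0, fun z hz => ?_⟩
  have hz' := offReal_subset_dom ν hz
  have i1 := integrable_paramFun k1 hz'
  have i2 := integrable_paramFun k2 hz'
  have i3 := integrable_paramFun k3 hz'
  have i4 := integrable_paramFun k4 hz'
  rw [hg hz']
  simp only [paramFun, add_sub_add_comm]
  have hadd := integral_add (i1.sub i2) ((i3.sub i4).const_mul Complex.I)
  simp only [Pi.sub_apply] at hadd
  rw [← integral_sub i1 i2, ← integral_sub i3 i4, mul_add, add_add_add_comm,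
    ← integral_const_mul, ← hadd]
  congr 1
  · simp [mul_comm Complex.I]
  · refine integral_congr_ae (Eventually.of_forall fun t => ?_)
    have hmm : ∀ x : ℝ, ((max x 0 : ℝ) : ℂ) - ((max (-x) 0 : ℝ) : ℂ) = x := fun x => by
      rw [← Complex.ofReal_sub, max_zero_sub_max_neg_zero_eq_self]
    have hq' : q t = ((q t).re : ℂ) + Complex.I * ((q t).im : ℂ) := by
      rw [mul_comm, Complex.re_add_im]
    simp only [mul_div_cancel_right₀ _ (ofReal_sub_I_ne_zero t)]
    change _ * q t = _
    linear_combination ((1 + (t : ℂ) * z) / ((t : ℂ) - z)) *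
      (hq' - hmm (q t).re - Complex.I * hmm (q t).im)

end QuasiHerglotz

theorem mainTheorem7 (h : ℂ → ℂ) (c : ℂ) (ν : MeasureTheory.Measure ℝ)
    [MeasureTheory.IsFiniteMeasure ν] (hh : QuasiHerglotz.IsRepresentedBy h c ν) :
    MeasureTheory.MemLp (fun t : ℝ => 1 / ((t : ℂ) - Complex.I)) 2 (QuasiHerglotz.weighted ν) ∧
    (∀ f : ℝ → ℂ, MeasureTheory.MemLp f 2 (QuasiHerglotz.weighted ν) →
      MeasureTheory.Integrable (fun t : ℝ => f t / ((t : ℂ) - Complex.I))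
        (QuasiHerglotz.weighted ν)) ∧
    (∀ g : ℂ → ℂ, g ∈ QuasiHerglotz.spaceM h (QuasiHerglotz.dom ν) ↔
      ∃ (f : ℝ → ℂ) (a : ℂ), MeasureTheory.MemLp f 2 (QuasiHerglotz.weighted ν) ∧
        ∀ z ∈ QuasiHerglotz.dom ν,
          g z = QuasiHerglotz.paramFun (QuasiHerglotz.weighted ν) f a z) ∧
    (∀ g : ℂ → ℂ, g ∈ QuasiHerglotz.spaceM h (QuasiHerglotz.dom ν) ↔
      AnalyticOnNhd ℂ g (QuasiHerglotz.dom ν) ∧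
      ∃ (f : ℝ → ℂ) (a : ℂ), MeasureTheory.MemLp f 2 (QuasiHerglotz.weighted ν) ∧
        ∀ z ∈ QuasiHerglotz.offReal,
          g z = QuasiHerglotz.paramFun (QuasiHerglotz.weighted ν) f a z) ∧
    (∀ g ∈ QuasiHerglotz.spaceM h (QuasiHerglotz.dom ν), QuasiHerglotz.IsQuasiHerglotz g) := by
  have hmemM := hh.mem_spaceM_iff
  refine ⟨QuasiHerglotz.memLp_inv_ofReal_sub_I ν,
    fun f hf => QuasiHerglotz.integrable_div_sub hf (QuasiHerglotz.I_mem_dom ν), hmemM,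
    fun g => ⟨fun hg => ?_, ?_⟩, fun g hg => ?_⟩
  · obtain ⟨f, a, hf, hfg⟩ := (hmemM g).1 hg
    exact ⟨hg.1, f, a, hf, fun z hz => hfg z (QuasiHerglotz.offReal_subset_dom ν hz)⟩
  · rintro ⟨hg, f, a, hf, hfg⟩
    -- Both sides are continuous on the domain and ℂ \ ℝ is dense, so the formula extends across the
    -- real points of the domain.
    exact (hmemM g).2 ⟨f, a, hf, QuasiHerglotz.eqOn_dom_of_eqOn_offReal hg.continuousOn
      (QuasiHerglotz.analyticOnNhd_of_eqOn_paramFun hf (Set.eqOn_refl _ _)).continuousOn hfg⟩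
  · obtain ⟨f, a, hf, hfg⟩ := (hmemM g).1 hg
    exact QuasiHerglotz.isQuasiHerglotz_of_eqOn_paramFun hf hfg
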